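/- Let $m\ge 1$ parties hold systems with finite-dimensional local Hilbert spaces, let $\Psi$ be a pure state (unit vector) of $\bigotimes_{\ell=1}^m\mathbb C^{d_\ell}$ and $\Phi$ a pure state of $\bigotimes_{\ell=1}^m\mathbb C^{e_\ell}$. Suppose that $\Psi$ and $\Phi$ are marginally isentropic: $S(\rho_\ell(\Psi))=S(\rho_\ell(\Phi))$ for each party $\ell$, where $\rho_\ell(\Psi)=\operatorname{tr}_{\overline{\{\ell\}}}|\Psi\rangle\langle\Psi|$ is the marginal density matrix of party $\ell$ and $S(\rho)=-\operatorname{tr}(\rho\log_2\rho)$. Then at least one of the following holds. (a) $\Psi$ and $\Phi$ are locally unitarily (isometrically) equivalent: there are dimensions $f_\ell$ and isometries $V_\ell:\mathbb C^{d_\ell}\to\mathbb C^{f_\ell}$, $W_\ell:\mathbb C^{e_\ell}\to\mathbb C^{f_\ell}$ with $(V_1\otimes\cdots\otimes V_m)\Psi=(W_1\otimes\cdots\otimes W_m)\Phi$. (b) $\Psi$ and $\Phi$ are LOCC-incomparable: there is no trace-preserving superoperator $\mathcal L$, implementable by local operations and classical communication, with $\mathcal L(|\Psi\rangle\langle\Psi|)=|\Phi\rangle\langle\Phi|$,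 and none with $\mathcal L(|\Phi\rangle\langle\Phi|)=|\Psi\rangle\langle\Psi|$. Here an LOCC superoperator is one given by a finite protocol in which, at each step, one party performs a quantum instrument with finitely many outcomes on its own system (each outcome being a completely positive map given by finitely many Kraus operators, possibly changing that party's finite local dimension; the outcomes together preserve the trace) and announces the outcome to all parties, whose later actions may depend on it; the final state is averaged over all outcomes. -/

import Mathlib

open scoped Matrix

noncomputable section

namespace MultiLOCC

universe u

variable {ι : Type u} [Fintype ι] [DecidableEq ι]

/-- The product basis of the joint Hilbert space `⨂ⱼ ℂ ^ (d j)` of the parties `j : ι`,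
party `j` holding a system with local Hilbert space `ℂ ^ (d j)`. -/
abbrev Idx (d : ι → ℕ) : Type u := ∀ j, Fin (d j)

/-- The joint Hilbert space of the parties, `⨂ⱼ ℂ ^ (d j)`, written in the product basis.
A pure state is a vector of norm `1` in it. -/
abbrev JointSpace (d : ι → ℕ) : Type u := EuclideanSpace ℂ (Idx d)

/-- Operators on the joint Hilbert space. -/
abbrev JointOp (d : ι → ℕ) : Type u := Matrix (Idx d) (Idx d) ℂ

/-- The projector `|Ψ⟩⟨Ψ|`. -/
def proj {d : ι → ℕ} (Ψ : JointSpace d) : JointOp d :=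
  Matrix.of fun x y => Ψ x * star (Ψ y)

/-- The partial trace of `ρ` over all parties except `ℓ`. -/
def marginal {d : ι → ℕ} (ℓ : ι) (ρ : JointOp d) : Matrix (Fin (d ℓ)) (Fin (d ℓ)) ℂ :=
  Matrix.of fun a b => ∑ z : (∀ j : {j // j ≠ ℓ}, Fin (d j)),
    ρ ((Equiv.piSplitAt ℓ fun j => Fin (d j)).symm (a, z))
      ((Equiv.piSplitAt ℓ fun j => Fin (d j)).symm (b, z))

/-- The von Neumann entropy `S(ρ) = - tr (ρ log₂ ρ)`; the matrix logarithm is taken by the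
functional calculus of Hermitian matrices, and `0 log₂ 0 = 0` holds because `Real.logb 2 0 = 0`. -/
def vonNeumannEntropy {n : ℕ} (ρ : Matrix (Fin n) (Fin n) ℂ) : ℝ :=
  -(Matrix.trace (ρ * cfc (Real.logb 2) ρ)).re

/-- The marginal entropy of party `ℓ` in the pure state `Ψ`. -/
def marginalEntropy {d : ι → ℕ} (ℓ : ι) (Ψ : JointSpace d) : ℝ :=
  vonNeumannEntropy (marginal ℓ (proj Ψ))

/-- Every party has the same marginal entropy in the two states. -/
def MarginallyIsentropic {d e : ι → ℕ} (Ψ : JointSpace d) (Φ : JointSpace e) : Prop :=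
  ∀ ℓ, marginalEntropy ℓ Ψ = marginalEntropy ℓ Φ

/-- The product operator `⨂ⱼ A j`. -/
def tensorOp {d e : ι → ℕ} (A : ∀ j, Matrix (Fin (e j)) (Fin (d j)) ℂ) :
    Matrix (Idx e) (Idx d) ℂ :=
  Matrix.of fun x y => ∏ j, A j (x j) (y j)

/-- Local unitary equivalence, allowing changes of the local dimensions: after embedding each local
space isometrically in a common larger one, the two states coincide. -/
def LUEquivalent {d e : ι → ℕ} (Ψ : JointSpace d) (Φ : JointSpace e) : Prop :=
  ∃ (f : ι → ℕ) (V : ∀ j, Matrix (Fin (f j)) (Fin (d j)) ℂ)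
    (W : ∀ j, Matrix (Fin (f j)) (Fin (e j)) ℂ),
    (∀ j, (V j)ᴴ * V j = 1) ∧ (∀ j, (W j)ᴴ * W j = 1) ∧
      tensorOp V *ᵥ Ψ.ofLp = tensorOp W *ᵥ Φ.ofLp

/-- The operator `K ⊗ 1` that acts as `K` on party `i` and as the identity on the other parties.
It is used only when `d' j = d j` for all `j ≠ i`; comparing the basis labels of the other parties
as natural numbers identifies `Fin (d' j)` with `Fin (d j)`. -/
def localOp {d d' : ι → ℕ} (i : ι) (K : Matrix (Fin (d' i)) (Fin (d i)) ℂ) :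
    Matrix (Idx d') (Idx d) ℂ :=
  Matrix.of fun x y => if ∀ j, j ≠ i → (x j : ℕ) = (y j : ℕ) then K (x i) (y i) else 0

/-- The completely positive map `ρ ↦ ∑ₗ (K l ⊗ 1) ρ (K l ⊗ 1)†` in which only party `i` acts. -/
def localMap {d d' : ι → ℕ} (i : ι) {r : ℕ} (K : Fin r → Matrix (Fin (d' i)) (Fin (d i)) ℂ) :
    JointOp d →ₗ[ℂ] JointOp d' where
  toFun ρ := ∑ l, localOp i (K l) * ρ * (localOp i (K l))ᴴ
  map_add' ρ σ := by
    simp only [Matrix.mul_add, Matrix.add_mul, Finset.sum_add_distrib]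
  map_smul' c ρ := by
    simp only [Matrix.mul_smul, Matrix.smul_mul, Finset.smul_sum, RingHom.id_apply]

/-- The trace-preserving superoperators that are implemented by a finite protocol of local
operations and classical communication. Either the protocol stops; or some party `i` performs a
quantum instrument on its system (outcome `k` is the completely positive map with Kraus operators
`K k l`, and can lead to a new local dimension `d' k i`; the completeness relation says that the
outcomes together preserve the trace), announces the outcome `k`, and all parties go on with an
LOCC protocol that depends on `k`. The final state is averaged over all outcomes. Local unitaries,
ancillas, measurements (with outcomes announced, kept or forgotten), discarding of subsystems, and
random choices are all instruments. -/
inductive IsLOCC : ∀ {d e : ι → ℕ}, (JointOp d →ₗ[ℂ] JointOp e) → Prop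
  | halt (d : ι → ℕ) : IsLOCC (LinearMap.id : JointOp d →ₗ[ℂ] JointOp d)
  | step {d e : ι → ℕ} (i : ι) (n : ℕ) (d' : Fin n → ι → ℕ)
      (hd' : ∀ k j, j ≠ i → d' k j = d j) (r : Fin n → ℕ)
      (K : ∀ k, Fin (r k) → Matrix (Fin (d' k i)) (Fin (d i)) ℂ)
      (hK : ∑ k, ∑ l, (K k l)ᴴ * K k l = 1)
      (L : ∀ k, JointOp (d' k) →ₗ[ℂ] JointOp e)
      (hL : ∀ k, IsLOCC (L k)) :
      IsLOCC (∑ k, L k ∘ₗ localMap i (K k))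

/-- `Φ` is exactly reducible to `Ψ`: some LOCC protocol converts `Ψ` to `Φ` with certainty. -/
def ExactlyReducible {d e : ι → ℕ} (Φ : JointSpace e) (Ψ : JointSpace d) : Prop :=
  ∃ L : JointOp d →ₗ[ℂ] JointOp e, IsLOCC L ∧ proj Φ = L (proj Ψ)

/-- Neither state is exactly reducible to the other. -/
def LOCCIncomparable {d e : ι → ℕ} (Ψ : JointSpace d) (Φ : JointSpace e) : Prop :=
  ¬ ExactlyReducible Φ Ψ ∧ ¬ ExactlyReducible Ψ Φ

end MultiLOCC

end

/-!
Suppose an LOCC protocol turns `Ψ` into `Φ`. Since `Φ` is pure, every branch of the protocol that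
has positive probability also ends in `Φ` (`eq_trace_smul_proj`), so the initial measurement can be
followed by an induction on the protocol, applied to the normalized post-measurement states.

A measurement by party `i` with Kraus operators `K x` leaves the average marginal of every other
party unchanged, and so, by concavity of the entropy, does not increase the average entropy of any
of those marginals (`sum_marginalEntropy_le_of_ne`). The entropy of party `i` itself equals that of
all other parties jointly (`matEntropy_mul_conjTranspose`), whose average state is also unchanged.
Hence all marginal entropies decrease weakly on average, and if initial and final entropies agree,
no step loses anything.
Strict concavity (`matEntropy_concave`, from the equality case of `klein_inequality`) then says
that no outcome of positive probability changes the joint state of the parties other than `i`. In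
terms of the matrix `M` of `Ψ` for the cut `i` against the rest this reads
`(K M)ᴴ (K M) = p Mᴴ M`: on the range of `M` the operator `K / √p` is isometric, so the
post-measurement state is obtained from `Ψ` by a contraction on party `i`
(`sum_marginalEntropy_le_self`).

Unlike partial isometries adapted to a state, contractions compose without any compatibility
condition, so `IsLOCC.marginalEntropy_le` gives contractions `A j` with `(⨂ A j) Ψ = Φ` up to a
phase. A contraction dilates to an isometry, and because `Ψ` and `Φ` have the same norm the part of
the dilated vector outside the original space vanishes. This is local unitary equivalence
(`luEquivalent_of_isContraction`).
-/

noncomputable section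

namespace MultiLOCC

universe u

/-! ### Entropy of positive semidefinite matrices -/

section Entropy

open Matrix
open scoped ComplexOrder

variable {m n : Type*} [Fintype m] [DecidableEq m] [Fintype n] [DecidableEq n]

/-- The von Neumann entropy of a matrix over an arbitrary finite index type. -/
def matEntropy (ρ : Matrix n n ℂ) : ℝ :=
  -(trace (ρ * cfc (Real.logb 2) ρ)).re

theorem vonNeumannEntropy_eq_matEntropy {k : ℕ} (ρ : Matrix (Fin k) (Fin k) ℂ) :
    vonNeumannEntropy ρ = matEntropy ρ := rfl

/-- On the (finite) spectra of two Hermitian matrices, any function agrees with a polynomial. -/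
theorem exists_polynomial_cfc_eq (f : ℝ → ℝ) {A : Matrix m m ℂ} {B : Matrix n n ℂ}
    (hA : A.IsHermitian) (hB : B.IsHermitian) :
    ∃ q : Polynomial ℝ, cfc f A = Polynomial.aeval A q ∧ cfc f B = Polynomial.aeval B q := by
  classical
  set s : Finset ℝ := (A.finite_real_spectrum.union B.finite_real_spectrum).toFinset with hs
  have hq : ∀ x ∈ s, (Lagrange.interpolate s id f).eval x = f x := fun x hx =>
    Lagrange.eval_interpolate_at_node f (Set.injOn_id _) hx
  refine ⟨Lagrange.interpolate s id f, ?_, ?_⟩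
  · rw [← cfc_polynomial _ A hA.isSelfAdjoint]
    exact cfc_congr fun x hx => (hq x (by simp [hs, hx])).symm
  · rw [← cfc_polynomial _ B hB.isSelfAdjoint]
    exact cfc_congr fun x hx => (hq x (by simp [hs, hx])).symm

theorem mul_aeval_conjTranspose_mul (M : Matrix m n ℂ) (q : Polynomial ℝ) :
    M * Polynomial.aeval (Mᴴ * M) q = Polynomial.aeval (M * Mᴴ) q * M := by
  induction q using Polynomial.induction_on' with
  | add p q hp hq => simp [Matrix.mul_add, Matrix.add_mul, hp, hq]
  | monomial k a =>
    have : M * (Mᴴ * M) ^ k = (M * Mᴴ) ^ k * M := by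
      induction k with
      | zero => simp
      | succ k ih =>
        rw [pow_succ, ← Matrix.mul_assoc, ih, pow_succ]
        simp only [Matrix.mul_assoc]
    simp [Polynomial.aeval_monomial, Algebra.algebraMap_eq_smul_one, this]

/-- The two marginals `M Mᴴ` and `Mᴴ M` of a bipartite pure state have the same entropy. -/
theorem matEntropy_mul_conjTranspose (M : Matrix m n ℂ) :
    matEntropy (M * Mᴴ) = matEntropy (Mᴴ * M) := by
  obtain ⟨q, h₁, h₂⟩ := exists_polynomial_cfc_eq (Real.logb 2)
    (posSemidef_self_mul_conjTranspose M).isHermitian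
    (posSemidef_conjTranspose_mul_self M).isHermitian
  unfold matEntropy
  rw [h₁, h₂, Matrix.mul_assoc Mᴴ, mul_aeval_conjTranspose_mul, ← Matrix.mul_assoc,
    Matrix.trace_mul_cycle, Matrix.trace_mul_comm]
  simp only [Matrix.mul_assoc]

/-- Spectral decomposition, simultaneous for all functions of a positive semidefinite matrix. -/
theorem exists_spectral_decomposition {σ : Matrix n n ℂ} (hσ : σ.PosSemidef) :
    ∃ (W : Matrix n n ℂ) (μ : n → ℝ), Wᴴ * W = 1 ∧ W * Wᴴ = 1 ∧ (∀ i, 0 ≤ μ i) ∧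
      σ = W * diagonal (fun i => (μ i : ℂ)) * Wᴴ ∧
      ∀ f : ℝ → ℝ, cfc f σ = W * diagonal (fun i => (f (μ i) : ℂ)) * Wᴴ := by
  have key : ∀ f : ℝ → ℝ, cfc f σ = (hσ.1.eigenvectorUnitary : Matrix n n ℂ) *
      diagonal (fun i => (f (hσ.1.eigenvalues i) : ℂ)) *
      (hσ.1.eigenvectorUnitary : Matrix n n ℂ)ᴴ := by
    intro f
    rw [hσ.1.cfc_eq f, IsHermitian.cfc, Unitary.conjStarAlgAut_apply]
    rfl
  refine ⟨hσ.1.eigenvectorUnitary, hσ.1.eigenvalues,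
    Unitary.coe_star_mul_self hσ.1.eigenvectorUnitary,
    Unitary.coe_mul_star_self hσ.1.eigenvectorUnitary, hσ.eigenvalues_nonneg, ?_, key⟩
  simpa [cfc_id' ℝ σ hσ.1.isSelfAdjoint] using key (fun x => x)

theorem trace_diagonal_conj_mul_diagonal_conj (W V : Matrix n n ℂ) (f g : n → ℝ) :
    (trace (W * diagonal (fun i => (f i : ℂ)) * Wᴴ * (V * diagonal (fun i => (g i : ℂ)) * Vᴴ))).re
      = ∑ b, ∑ a, f b * g a * ‖(Wᴴ * V) b a‖ ^ 2 := by
  have h : trace (W * diagonal (fun i => (f i : ℂ)) * Wᴴ *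
      (V * diagonal (fun i => (g i : ℂ)) * Vᴴ)) =
      trace (diagonal (fun i => (f i : ℂ)) * (Wᴴ * V) * diagonal (fun i => (g i : ℂ)) *
        (Wᴴ * V)ᴴ) := by
    rw [conjTranspose_mul, conjTranspose_conjTranspose, Matrix.mul_assoc W,
      Matrix.mul_assoc W, Matrix.trace_mul_comm W]
    simp only [Matrix.mul_assoc]
  rw [h]
  simp only [trace, diag_apply, Complex.re_sum]
  refine Finset.sum_congr rfl fun b _ => ?_
  rw [Matrix.mul_apply, Complex.re_sum]
  refine Finset.sum_congr rfl fun a _ => ?_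
  rw [Matrix.mul_diagonal, Matrix.diagonal_mul, conjTranspose_apply]
  generalize (Wᴴ * V) b a = z
  have : (f b : ℂ) * z * (g a : ℂ) * star z = ((f b * g a * ‖z‖ ^ 2 : ℝ) : ℂ) := by
    push_cast
    rw [← Complex.mul_conj']
    simp only [Complex.star_def]
    ring
  rw [this, Complex.ofReal_re]

/-- The scalar form of Klein's inequality, from `log t ≤ t - 1` at `t = y / x`. -/
theorem logb_klein {x y : ℝ} (hx : 0 ≤ x) (hy : 0 < y) :
    (x - y) / Real.log 2 ≤ x * Real.logb 2 x - x * Real.logb 2 y ∧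
      (x * Real.logb 2 x - x * Real.logb 2 y = (x - y) / Real.log 2 → x = y) := by
  have h2 : 0 < Real.log 2 := Real.log_pos one_lt_two
  have e : x * Real.logb 2 x - x * Real.logb 2 y =
      (x * Real.log x - x * Real.log y) / Real.log 2 := by
    simp only [Real.logb]; ring
  rw [e, div_le_div_iff_of_pos_right h2, div_left_inj' h2.ne']
  rcases hx.eq_or_lt with rfl | hx
  · constructor
    · simp [hy.le]
    · intro h; simpa [eq_comm] using h
  · have hlog : Real.log x - Real.log y = - Real.log (y / x) := by
      rw [Real.log_div hy.ne' hx.ne']; ring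
    have hyx : x * (y / x) = y := by field_simp
    rw [← mul_sub, hlog]
    constructor
    · nlinarith [Real.log_le_sub_one_of_pos (div_pos hy hx)]
    · intro h
      by_contra hne
      have := Real.log_lt_sub_one_of_pos (div_pos hy hx)
        (fun h1 => hne ((div_eq_one_iff_eq hx.ne').1 h1).symm)
      nlinarith

/-- **Klein's inequality** for the relative entropy, with its equality case. The support condition
`hsupp` is what makes the convention `log 0 = 0` harmless. -/
theorem klein_inequality {σ ρ : Matrix n n ℂ} (hσ : σ.PosSemidef) (hρ : ρ.PosSemidef)
    (hsupp : ∀ v, ρ *ᵥ v = 0 → σ *ᵥ v = 0) :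
    ((trace σ).re - (trace ρ).re) / Real.log 2 ≤
        -matEntropy σ - (trace (σ * cfc (Real.logb 2) ρ)).re ∧
      (-matEntropy σ - (trace (σ * cfc (Real.logb 2) ρ)).re =
        ((trace σ).re - (trace ρ).re) / Real.log 2 → σ = ρ) := by
  obtain ⟨W, μ, hW, hW', hμ, hσW, hfW⟩ := exists_spectral_decomposition hσ
  obtain ⟨V, l, hV, hV', hl, hρV, hfV⟩ := exists_spectral_decomposition hρ
  set U := Wᴴ * V with hU
  have one_eq : ∀ {X : Matrix n n ℂ}, X * Xᴴ = 1 →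
      X * diagonal (fun _ => ((1 : ℝ) : ℂ)) * Xᴴ = 1 := by
    intro X hX
    rw [show diagonal (fun _ => ((1 : ℝ) : ℂ)) = (1 : Matrix n n ℂ) by simp, Matrix.mul_one, hX]
  -- each of the four traces is a sum over pairs of eigenvectors, weighted by the overlaps
  have t1 : (trace σ).re = ∑ b, ∑ a, μ b * 1 * ‖U b a‖ ^ 2 := by
    rw [← trace_diagonal_conj_mul_diagonal_conj W V μ (fun _ => 1), one_eq hV', ← hσW,
      Matrix.mul_one]
  have t2 : (trace ρ).re = ∑ b, ∑ a, 1 * l a * ‖U b a‖ ^ 2 := by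
    rw [← trace_diagonal_conj_mul_diagonal_conj W V (fun _ => 1) l, one_eq hW', ← hρV,
      Matrix.one_mul]
  have t3 : -matEntropy σ = ∑ b, ∑ a, (μ b * Real.logb 2 (μ b)) * 1 * ‖U b a‖ ^ 2 := by
    rw [← trace_diagonal_conj_mul_diagonal_conj W V (fun b => μ b * Real.logb 2 (μ b))
      (fun _ => 1), one_eq hV', Matrix.mul_one, matEntropy, neg_neg, hfW]
    conv_lhs => rw [hσW]
    congr 2
    calc W * diagonal (fun i => (μ i : ℂ)) * Wᴴ *
          (W * diagonal (fun i => (Real.logb 2 (μ i) : ℂ)) * Wᴴ)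
        = W * diagonal (fun i => (μ i : ℂ)) * (Wᴴ * W) *
          diagonal (fun i => (Real.logb 2 (μ i) : ℂ)) * Wᴴ := by simp only [Matrix.mul_assoc]
      _ = _ := by
        rw [hW, Matrix.mul_one, Matrix.mul_assoc W, diagonal_mul_diagonal]
        simp
  have t4 : (trace (σ * cfc (Real.logb 2) ρ)).re =
      ∑ b, ∑ a, μ b * Real.logb 2 (l a) * ‖U b a‖ ^ 2 := by
    rw [← trace_diagonal_conj_mul_diagonal_conj W V μ (fun a => Real.logb 2 (l a)), hfV, ← hσW]
  have hzero : ∀ b a, l a = 0 → μ b = 0 ∨ U b a = 0 := by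
    intro b a ha
    have h1 : ρ *ᵥ (V *ᵥ Pi.single a 1) = 0 := by
      rw [hρV, mulVec_mulVec, Matrix.mul_assoc, hV, Matrix.mul_one, ← mulVec_mulVec,
        show diagonal (fun i => (l i : ℂ)) *ᵥ Pi.single a 1 = 0 from ?_, mulVec_zero]
      ext i
      rw [mulVec_diagonal]
      by_cases h : i = a
      · subst h; simp [ha]
      · simp [h]
    have h2 := hsupp _ h1
    have h3 : (Wᴴ *ᵥ (σ *ᵥ (V *ᵥ Pi.single a 1))) b = μ b * U b a := by
      rw [hσW, mulVec_mulVec, mulVec_mulVec, ← Matrix.mul_assoc, ← Matrix.mul_assoc, hW,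
        Matrix.one_mul, Matrix.mul_assoc, ← hU, mulVec_single_one, col_apply, diagonal_mul]
    rw [h2, mulVec_zero] at h3
    simpa using h3.symm
  have hterm : ∀ b a, 0 ≤ (μ b * Real.logb 2 (μ b) - μ b * Real.logb 2 (l a) -
        (μ b - l a) / Real.log 2) * ‖U b a‖ ^ 2 ∧
      ((μ b * Real.logb 2 (μ b) - μ b * Real.logb 2 (l a) -
        (μ b - l a) / Real.log 2) * ‖U b a‖ ^ 2 = 0 → μ b = l a ∨ U b a = 0) := by
    intro b a
    rcases (hl a).eq_or_lt with h0 | h0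
    · rcases hzero b a h0.symm with h | h
      · simp [h, ← h0]
      · simp [h]
    · obtain ⟨k1, k2⟩ := logb_klein (hμ b) h0
      refine ⟨mul_nonneg (by linarith) (by positivity), fun h => ?_⟩
      rcases mul_eq_zero.1 h with h | h
      · exact Or.inl (k2 (by linarith))
      · exact Or.inr (by simpa using h)
  have hsum : -matEntropy σ - (trace (σ * cfc (Real.logb 2) ρ)).re -
      ((trace σ).re - (trace ρ).re) / Real.log 2 =
      ∑ b, ∑ a, (μ b * Real.logb 2 (μ b) - μ b * Real.logb 2 (l a) -
        (μ b - l a) / Real.log 2) * ‖U b a‖ ^ 2 := by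
    rw [t1, t2, t3, t4]
    simp only [← Finset.sum_sub_distrib, Finset.sum_div]
    refine Finset.sum_congr rfl fun b _ => Finset.sum_congr rfl fun a _ => ?_
    ring
  have hnn := Finset.sum_nonneg fun b (_ : b ∈ Finset.univ) =>
    Finset.sum_nonneg fun a (_ : a ∈ Finset.univ) => (hterm b a).1
  refine ⟨by linarith, fun heq => ?_⟩
  rw [heq, sub_self, eq_comm, Finset.sum_eq_zero_iff_of_nonneg fun b _ =>
    Finset.sum_nonneg fun a _ => (hterm b a).1] at hsum
  have hcomm : diagonal (fun i => (μ i : ℂ)) * U = U * diagonal (fun i => (l i : ℂ)) := by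
    ext b a
    rw [diagonal_mul, mul_diagonal]
    have := (Finset.sum_eq_zero_iff_of_nonneg fun a _ => (hterm b a).1).1
      (hsum b (Finset.mem_univ _)) a (Finset.mem_univ _)
    rcases (hterm b a).2 this with h | h
    · rw [h, mul_comm]
    · simp [h]
  calc σ = W * (diagonal (fun i => (μ i : ℂ)) * U) * Vᴴ := by
        rw [hU]
        simp only [Matrix.mul_assoc]
        rw [hV', Matrix.mul_one, ← Matrix.mul_assoc]
        exact hσW
    _ = (W * Wᴴ) * (V * diagonal (fun i => (l i : ℂ)) * Vᴴ) := by
        rw [hcomm, hU]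
        simp only [Matrix.mul_assoc]
    _ = ρ := by rw [hW', Matrix.one_mul, ← hρV]

/-- **Strict concavity of the entropy**: mixing does not decrease the average entropy, and if it
keeps it then all states of positive weight are equal to the mixture. -/
theorem matEntropy_concave {X : Type*} [Fintype X] (p : X → ℝ) (hp : ∀ x, 0 ≤ p x)
    (hp1 : ∑ x, p x = 1) (σ : X → Matrix n n ℂ) (hσ : ∀ x, (σ x).PosSemidef)
    {ρ : Matrix n n ℂ} (hρ : ∑ x, (p x : ℂ) • σ x = ρ) :
    ∑ x, p x * matEntropy (σ x) ≤ matEntropy ρ ∧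
      (∑ x, p x * matEntropy (σ x) = matEntropy ρ → ∀ x, 0 < p x → σ x = ρ) := by
  have hpc : ∀ x, (0 : ℂ) ≤ p x := fun x => by exact_mod_cast hp x
  have hρpsd : ρ.PosSemidef := by
    rw [← hρ]
    exact posSemidef_sum _ fun x _ => (hσ x).smul (hpc x)
  have hsupp : ∀ x, 0 < p x → ∀ v, ρ *ᵥ v = 0 → σ x *ᵥ v = 0 := by
    intro x hx v hv
    have h1 : ∑ y, (p y : ℂ) * (star v ⬝ᵥ (σ y *ᵥ v)) = 0 := by
      have : star v ⬝ᵥ (ρ *ᵥ v) = 0 := by rw [hv, dotProduct_zero]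
      rw [← this, ← hρ, Matrix.sum_mulVec, dotProduct_sum]
      simp [smul_mulVec]
    have h2 := (Finset.sum_eq_zero_iff_of_nonneg fun y _ =>
      mul_nonneg (hpc y) ((hσ y).dotProduct_mulVec_nonneg v)).1 h1 x (Finset.mem_univ _)
    refine ((hσ x).dotProduct_mulVec_zero_iff v).1 ((mul_eq_zero.1 h2).resolve_left ?_)
    exact_mod_cast hx.ne'
  have hk : ∀ x, p x * (((trace (σ x)).re - (trace ρ).re) / Real.log 2) ≤
      p x * (-matEntropy (σ x) - (trace (σ x * cfc (Real.logb 2) ρ)).re) := by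
    intro x
    rcases (hp x).eq_or_lt with h | h
    · simp [← h]
    · exact mul_le_mul_of_nonneg_left (klein_inequality (hσ x) hρpsd (hsupp x h)).1 h.le
  have hre : ∀ (c : ℝ) (z : ℂ), ((c : ℂ) • z).re = c * z.re := fun c z => by simp
  have hl : ∑ x, p x * (((trace (σ x)).re - (trace ρ).re) / Real.log 2) = 0 := by
    have : ∑ x, p x * (trace (σ x)).re = (trace ρ).re := by
      rw [← hρ, trace_sum, Complex.re_sum]
      simp only [trace_smul, hre]
    simp only [mul_div_assoc', ← Finset.sum_div, mul_sub, Finset.sum_sub_distrib, this,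
      ← Finset.sum_mul, hp1, one_mul, sub_self, zero_div]
  have hr : ∑ x, p x * (-matEntropy (σ x) - (trace (σ x * cfc (Real.logb 2) ρ)).re) =
      matEntropy ρ - ∑ x, p x * matEntropy (σ x) := by
    have : ∑ x, p x * (trace (σ x * cfc (Real.logb 2) ρ)).re = -matEntropy ρ := by
      rw [matEntropy, neg_neg]
      conv_rhs => rw [← hρ, Finset.sum_mul, trace_sum, Complex.re_sum, hρ]
      simp only [Matrix.smul_mul, trace_smul, hre]
    simp only [mul_sub, Finset.sum_sub_distrib, this, mul_neg, Finset.sum_neg_distrib]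
    ring
  have hle := Finset.sum_le_sum fun x (_ : x ∈ Finset.univ) => hk x
  refine ⟨by linarith, fun heq x hx => ?_⟩
  have := (Finset.sum_eq_sum_iff_of_le fun x _ => hk x).1 (by linarith) x (Finset.mem_univ _)
  exact (klein_inequality (hσ x) hρpsd (hsupp x hx)).2 (mul_left_cancel₀ hx.ne' this).symm

end Entropy

/-! ### Product operators and local operators -/

section Operators

open Matrix
open scoped ComplexOrder

variable {ι : Type u} [Fintype ι] [DecidableEq ι]

/-- The matrix that identifies basis vectors with equal labels. It is used for `m = k`, where it is
the identity up to a cast of the index types. -/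
def relabel (m k : ℕ) : Matrix (Fin m) (Fin k) ℂ :=
  of fun a b => if (a : ℕ) = b then 1 else 0

theorem relabel_self (m : ℕ) : relabel m m = 1 := by
  ext a b
  simp [relabel, one_apply, Fin.ext_iff]

theorem relabel_conjTranspose_mul_self {m k : ℕ} (h : m = k) :
    (relabel m k)ᴴ * relabel m k = 1 := by
  subst h
  simp [relabel_self]

theorem submatrix_cast_mul_relabel {m k : ℕ} (h : m = k) (X : Matrix (Fin k) (Fin k) ℂ) :
    X.submatrix (Fin.cast h) (Fin.cast h) * relabel m k = relabel m k * X := by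
  subst h
  simp [relabel_self]

theorem tensorOp_mul {d d' e : ι → ℕ} (A : ∀ j, Matrix (Fin (e j)) (Fin (d' j)) ℂ)
    (B : ∀ j, Matrix (Fin (d' j)) (Fin (d j)) ℂ) :
    tensorOp A * tensorOp B = tensorOp fun j => A j * B j := by
  ext x z
  simp only [tensorOp, mul_apply, of_apply, ← Finset.prod_mul_distrib]
  rw [Finset.prod_univ_sum, Fintype.piFinset_univ]

omit [DecidableEq ι] in
theorem tensorOp_conjTranspose {d e : ι → ℕ} (A : ∀ j, Matrix (Fin (e j)) (Fin (d j)) ℂ) :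
    (tensorOp A)ᴴ = tensorOp fun j => (A j)ᴴ := by
  ext x y
  simp [tensorOp, conjTranspose_apply]

omit [DecidableEq ι] in
theorem tensorOp_one (d : ι → ℕ) :
    tensorOp (fun j => (1 : Matrix (Fin (d j)) (Fin (d j)) ℂ)) = 1 := by
  ext x y
  simp only [tensorOp, of_apply, one_apply]
  by_cases h : x = y
  · simp [h]
  · rw [if_neg h]
    obtain ⟨j, hj⟩ := Function.ne_iff.1 h
    exact Finset.prod_eq_zero (Finset.mem_univ j) (if_neg hj)

/-- The family of matrices whose tensor product is `localOp i K`. -/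
def localFamily {d d' : ι → ℕ} (i : ι) (K : Matrix (Fin (d' i)) (Fin (d i)) ℂ) :
    ∀ j, Matrix (Fin (d' j)) (Fin (d j)) ℂ :=
  Function.update (fun j => relabel (d' j) (d j)) i K

omit [Fintype ι] in
theorem localFamily_self {d d' : ι → ℕ} (i : ι) (K : Matrix (Fin (d' i)) (Fin (d i)) ℂ) :
    localFamily i K i = K := Function.update_self ..

omit [Fintype ι] in
theorem localFamily_of_ne {d d' : ι → ℕ} {i j : ι} (h : j ≠ i)
    (K : Matrix (Fin (d' i)) (Fin (d i)) ℂ) :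
    localFamily i K j = relabel (d' j) (d j) := Function.update_of_ne h ..

theorem localOp_eq_tensorOp {d d' : ι → ℕ} (i : ι) (K : Matrix (Fin (d' i)) (Fin (d i)) ℂ) :
    localOp i K = tensorOp (localFamily i K) := by
  ext x y
  simp only [localOp, tensorOp, of_apply]
  rw [← Finset.mul_prod_erase _ _ (Finset.mem_univ i), localFamily_self]
  split_ifs with h
  · rw [Finset.prod_eq_one, mul_one]
    intro j hj
    rw [localFamily_of_ne (Finset.ne_of_mem_erase hj)]
    simp [relabel, h j (Finset.ne_of_mem_erase hj)]
  · push Not at h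
    obtain ⟨j, hj, hxy⟩ := h
    rw [Finset.prod_eq_zero (Finset.mem_erase.2 ⟨hj, Finset.mem_univ j⟩), mul_zero]
    rw [localFamily_of_ne hj]
    simp [relabel, hxy]

theorem localOp_one (d : ι → ℕ) (i : ι) :
    localOp i (1 : Matrix (Fin (d i)) (Fin (d i)) ℂ) = 1 := by
  rw [localOp_eq_tensorOp, ← tensorOp_one]
  congr 1
  funext j
  by_cases h : j = i
  · subst h
    exact localFamily_self j _
  · rw [localFamily_of_ne h, relabel_self]

theorem localOp_sum {d d' : ι → ℕ} (i : ι) {X : Type*} (s : Finset X)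
    (K : X → Matrix (Fin (d' i)) (Fin (d i)) ℂ) :
    localOp i (∑ x ∈ s, K x) = ∑ x ∈ s, localOp i (K x) := by
  ext x y
  simp only [localOp, of_apply, Matrix.sum_apply]
  split_ifs <;> simp

theorem localOp_conjTranspose_mul_self {d d' : ι → ℕ} (i : ι) (hd : ∀ j, j ≠ i → d' j = d j)
    (K : Matrix (Fin (d' i)) (Fin (d i)) ℂ) :
    (localOp i K)ᴴ * localOp i K = localOp i (Kᴴ * K) := by
  rw [localOp_eq_tensorOp, tensorOp_conjTranspose, tensorOp_mul, localOp_eq_tensorOp]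
  congr 1
  funext j
  by_cases h : j = i
  · subst h
    simp only [localFamily_self]
  · simp only [localFamily_of_ne h, relabel_conjTranspose_mul_self (hd j h), relabel_self]

/-- Operators of different parties commute. -/
theorem localOp_mul_localOp_of_ne {d d' : ι → ℕ} {i l : ι} (hl : l ≠ i)
    (hd : ∀ j, j ≠ i → d' j = d j) (K : Matrix (Fin (d' i)) (Fin (d i)) ℂ)
    (X : Matrix (Fin (d l)) (Fin (d l)) ℂ) :
    (localOp l (X.submatrix (Fin.cast (hd l hl)) (Fin.cast (hd l hl))) : JointOp d') * localOp i K =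
      localOp i K * (localOp l X : JointOp d) := by
  simp only [localOp_eq_tensorOp, tensorOp_mul]
  congr 1
  funext j
  by_cases h : j = l
  · subst h
    rw [localFamily_self, localFamily_self, localFamily_of_ne hl,
      submatrix_cast_mul_relabel (hd j hl)]
  · rw [localFamily_of_ne h, localFamily_of_ne h, relabel_self, relabel_self, Matrix.one_mul,
      Matrix.mul_one]

theorem localOp_piSplitAt {d d' : ι → ℕ} (i : ι) (K : Matrix (Fin (d' i)) (Fin (d i)) ℂ)
    (a : Fin (d' i)) (b : Fin (d i)) (z : ∀ j : {j // j ≠ i}, Fin (d' j))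
    (w : ∀ j : {j // j ≠ i}, Fin (d j)) :
    localOp i K ((Equiv.piSplitAt i fun j => Fin (d' j)).symm (a, z))
      ((Equiv.piSplitAt i fun j => Fin (d j)).symm (b, w)) =
      if ∀ j, (z j : ℕ) = w j then K a b else 0 := by
  have h : (∀ j, j ≠ i → (((Equiv.piSplitAt i fun j => Fin (d' j)).symm (a, z) j : Fin _) : ℕ) =
      ((Equiv.piSplitAt i fun j => Fin (d j)).symm (b, w) j : Fin _)) ↔
      ∀ j, (z j : ℕ) = w j := by
    constructor
    · rintro h ⟨j, hj⟩
      simpa [Equiv.piSplitAt, hj] using h j hj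
    · intro h j hj
      simpa [Equiv.piSplitAt, hj] using h ⟨j, hj⟩
  simp only [localOp, of_apply, h]
  simp [Equiv.piSplitAt]

/-- The entries of a marginal are expectation values of operators of that party. -/
theorem marginal_apply_eq_trace {d : ι → ℕ} (l : ι) (ρ : JointOp d) (a b : Fin (d l)) :
    marginal l ρ a b = trace (localOp l (single b a (1 : ℂ)) * ρ) := by
  simp only [trace, diag_apply, mul_apply]
  rw [← (Equiv.piSplitAt l fun j => Fin (d j)).symm.sum_comp, Fintype.sum_prod_type]
  simp_rw [← (Equiv.piSplitAt l fun j => Fin (d j)).symm.sum_comp (fun y => _ * ρ y _),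
    Fintype.sum_prod_type, localOp_piSplitAt]
  have : ∀ z w : (∀ j : {j // j ≠ l}, Fin (d j)), (∀ j, (z j : ℕ) = w j) ↔ z = w := by
    intro z w
    simp [funext_iff, Fin.ext_iff]
  simp only [this, marginal, of_apply]
  rw [Finset.sum_eq_single b, Finset.sum_congr rfl]
  · intro z _
    rw [Finset.sum_eq_single a]
    · simp
    · intro a' _ ha
      simp [ha.symm]
    · simp
  · intro b' _ hb
    simp [hb.symm]
  · simp

/-! ### Pure states -/

/-- The image `A Ψ` of a vector of the joint space. -/
def opVec {d e : ι → ℕ} (A : Matrix (Idx e) (Idx d) ℂ) (Ψ : JointSpace d) : JointSpace e :=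
  WithLp.toLp 2 (A *ᵥ Ψ.ofLp)

omit [Fintype ι] [DecidableEq ι] in
theorem proj_eq_vecMulVec {d : ι → ℕ} (Ψ : JointSpace d) :
    proj Ψ = vecMulVec Ψ.ofLp (star Ψ.ofLp) := rfl

theorem proj_opVec {d e : ι → ℕ} (A : Matrix (Idx e) (Idx d) ℂ) (Ψ : JointSpace d) :
    proj (opVec A Ψ) = A * proj Ψ * Aᴴ := by
  rw [proj_eq_vecMulVec, proj_eq_vecMulVec, mul_vecMulVec, vecMulVec_mul, opVec, star_mulVec]

omit [Fintype ι] [DecidableEq ι] in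
theorem proj_smul {d : ι → ℕ} (c : ℝ) (Ψ : JointSpace d) :
    proj ((c : ℂ) • Ψ) = ((c ^ 2 : ℝ) : ℂ) • proj Ψ := by
  ext x y
  simp [proj]
  ring

omit [DecidableEq ι] in
theorem proj_posSemidef {d : ι → ℕ} (Ψ : JointSpace d) : (proj Ψ).PosSemidef :=
  posSemidef_vecMulVec_self_star _

theorem trace_proj {d : ι → ℕ} (Ψ : JointSpace d) : trace (proj Ψ) = ((‖Ψ‖ ^ 2 : ℝ) : ℂ) := by
  rw [EuclideanSpace.norm_sq_eq]
  simp [trace, proj, Complex.mul_conj']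

theorem proj_mul_proj {d : ι → ℕ} {Φ : JointSpace d} (hΦ : ‖Φ‖ = 1) :
    proj Φ * proj Φ = proj Φ := by
  have h := trace_proj Φ
  rw [proj_eq_vecMulVec, trace_vecMulVec, hΦ] at h
  rw [proj_eq_vecMulVec, vecMulVec_mul_vecMulVec, dotProduct_comm, h]
  simp

/-- A positive operator below a pure state is a multiple of it. -/
theorem eq_trace_smul_proj {d : ι → ℕ} {Φ : JointSpace d} (hΦ : ‖Φ‖ = 1) {X : JointOp d}
    (hX : X.PosSemidef) (hle : (proj Φ - X).PosSemidef) : X = trace X • proj Φ := by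
  have hP := proj_mul_proj hΦ
  have hPh : (proj Φ)ᴴ = proj Φ := (proj_posSemidef Φ).1
  set P := proj Φ with hPdef
  have hQ : (1 - P)ᴴ = 1 - P := by rw [conjTranspose_sub, conjTranspose_one, hPh]
  have h1 := hle.conjTranspose_mul_mul_same (1 - P)
  have h2 := hX.conjTranspose_mul_mul_same (1 - P)
  rw [hQ] at h1 h2
  have hPQ : P * (1 - P) = 0 := by rw [Matrix.mul_sub, Matrix.mul_one, hP, sub_self]
  rw [Matrix.mul_sub (1 - P) P, Matrix.sub_mul, Matrix.mul_assoc _ P, hPQ, Matrix.mul_zero,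
    zero_sub] at h1
  have h0 : (1 - P) * X * (1 - P) = 0 := by
    rw [← h2.trace_eq_zero_iff]
    have ht := h1.trace_nonneg
    rw [trace_neg] at ht
    exact le_antisymm (neg_nonneg.1 ht) h2.trace_nonneg
  obtain ⟨B, rfl⟩ : ∃ B : JointOp d, X = Bᴴ * B := by
    classical
    open scoped MatrixOrder in
    obtain ⟨B, hB⟩ := CStarAlgebra.nonneg_iff_eq_star_mul_self.1 hX.nonneg
    exact ⟨B, hB⟩
  have hB : B * (1 - P) = 0 := by
    rw [← conjTranspose_mul_self_eq_zero, conjTranspose_mul, hQ, ← h0]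
    simp only [Matrix.mul_assoc]
  have hBP : B = B * P := by
    rw [Matrix.mul_sub, Matrix.mul_one, sub_eq_zero] at hB
    exact hB
  have hX' : Bᴴ * B = P * (Bᴴ * B) * P := by
    conv_lhs => rw [hBP, conjTranspose_mul, hPh]
    simp only [Matrix.mul_assoc]
  have hmul : ∃ c : ℂ, Bᴴ * B = c • P := by
    refine ⟨star Φ.ofLp ⬝ᵥ ((Bᴴ * B) *ᵥ Φ.ofLp), ?_⟩
    conv_lhs => rw [hX']
    rw [hPdef, proj_eq_vecMulVec, vecMulVec_mul, vecMulVec_mul_vecMulVec,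
      ← dotProduct_mulVec, vecMulVec_smul]
  obtain ⟨c, hc⟩ := hmul
  have ht : trace (Bᴴ * B) = c := by
    rw [hc, trace_smul, hPdef, trace_proj, hΦ]
    simp
  rw [ht, hc]

/-- The vector `Ψ` as a matrix for the bipartition of party `i` against all other parties. -/
def cutMatrix {d : ι → ℕ} (i : ι) (Ψ : JointSpace d) :
    Matrix (Fin (d i)) (∀ j : {j // j ≠ i}, Fin (d j)) ℂ :=
  of fun a z => Ψ ((Equiv.piSplitAt i fun j => Fin (d j)).symm (a, z))

theorem marginal_proj {d : ι → ℕ} (i : ι) (Ψ : JointSpace d) :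
    marginal i (proj Ψ) = cutMatrix i Ψ * (cutMatrix i Ψ)ᴴ := by
  ext a b
  simp [marginal, proj, cutMatrix, mul_apply]

theorem marginal_posSemidef {d : ι → ℕ} (i : ι) (Ψ : JointSpace d) :
    (marginal i (proj Ψ)).PosSemidef := by
  rw [marginal_proj]
  exact posSemidef_self_mul_conjTranspose _

/-- A local operator of party `i` multiplies the matrix of the cut from the left. The columns are
indexed by the labels of the other parties, which the operator only casts. -/
theorem cutMatrix_opVec_localOp {d d' : ι → ℕ} (i : ι) (hd : ∀ j, j ≠ i → d' j = d j)
    (K : Matrix (Fin (d' i)) (Fin (d i)) ℂ) (Ψ : JointSpace d) :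
    cutMatrix i (opVec (localOp i K) Ψ) = (K * cutMatrix i Ψ).submatrix id
      (Equiv.piCongrRight fun j : {j // j ≠ i} => finCongr (hd j j.2)) := by
  ext a z
  simp only [cutMatrix, opVec, of_apply, submatrix_apply, id_eq, mul_apply, mulVec, dotProduct]
  rw [← (Equiv.piSplitAt i fun j => Fin (d j)).symm.sum_comp, Fintype.sum_prod_type]
  simp_rw [localOp_piSplitAt]
  refine Finset.sum_congr rfl fun b _ => ?_
  rw [Finset.sum_eq_single (Equiv.piCongrRight
    (fun j : {j // j ≠ i} => finCongr (hd j j.2)) z)]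
  · simp
  · intro w _ hw
    rw [if_neg, zero_mul]
    exact fun h => hw (funext fun j => Fin.ext (h j).symm)
  · simp

/-! ### Contractions -/

/-- A matrix of operator norm at most `1`. -/
def IsContraction {m n : Type*} [Fintype m] [DecidableEq n] (A : Matrix m n ℂ) : Prop :=
  (1 - Aᴴ * A).PosSemidef

theorem IsContraction.mul {m n k : Type*} [Fintype m] [Fintype n] [DecidableEq n] [DecidableEq k]
    [Finite k] {A : Matrix m n ℂ} {B : Matrix n k ℂ} (hA : IsContraction A) (hB : IsContraction B) :
    IsContraction (A * B) := by
  have h := PosSemidef.add hB (hA.conjTranspose_mul_mul_same B)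
  refine (congrArg PosSemidef ?_).mpr h
  rw [conjTranspose_mul, Matrix.mul_sub, Matrix.sub_mul, Matrix.mul_one]
  simp only [Matrix.mul_assoc]
  abel

theorem isContraction_of_conjTranspose_mul_self {m n : Type*} [Fintype m] [DecidableEq n]
    {A : Matrix m n ℂ} (hA : Aᴴ * A = 1) : IsContraction A := by
  rw [IsContraction, hA, sub_self]
  exact PosSemidef.zero

/-- If `K M` has the same Gram matrix as `√p M`, then `K / √p` acts on the range of `M` as a
contraction: compose it with the orthogonal projection onto that range. -/
theorem exists_isContraction_mul_eq {m n k : Type*} [Fintype m] [Fintype n] [DecidableEq n]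
    [Fintype k] (K : Matrix m n ℂ) (M : Matrix n k ℂ) {s : ℝ} (hs : 0 < s)
    (h : (K * M)ᴴ * (K * M) = ((s ^ 2 : ℝ) : ℂ) • (Mᴴ * M)) :
    ∃ A : Matrix m n ℂ, IsContraction A ∧ A * M = ((s⁻¹ : ℝ) : ℂ) • (K * M) := by
  obtain ⟨W, μ, hW, hW', -, hM, -⟩ :=
    exists_spectral_decomposition (posSemidef_self_mul_conjTranspose M)
  have hconj : ∀ f g : n → ℂ, W * diagonal f * Wᴴ * (W * diagonal g * Wᴴ) =
      W * diagonal (fun i => f i * g i) * Wᴴ := by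
    intro f g
    calc _ = W * diagonal f * (Wᴴ * W) * diagonal g * Wᴴ := by simp only [Matrix.mul_assoc]
      _ = _ := by rw [hW, Matrix.mul_one, Matrix.mul_assoc W, diagonal_mul_diagonal]
  -- the projection onto the range of `M`, and a factor `X` with `P = M * X`
  set P := W * diagonal (fun i => if μ i = 0 then (0 : ℂ) else 1) * Wᴴ with hP
  set X := Mᴴ * (W * diagonal (fun i => (μ i : ℂ)⁻¹) * Wᴴ) with hX
  have hPX : M * X = P := by
    rw [hX, ← Matrix.mul_assoc, hM, hconj, hP]
    congr 3
    funext i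
    by_cases hi : μ i = 0 <;> simp [hi]
  have hPh : Pᴴ = P := by
    simp only [hP, conjTranspose_mul, conjTranspose_conjTranspose, diagonal_conjTranspose,
      Matrix.mul_assoc]
    congr 3
    funext i
    by_cases hi : μ i = 0 <;> simp [hi]
  have hPP : P * P = P := by
    rw [hP, hconj]
    congr 3
    funext i
    by_cases hi : μ i = 0 <;> simp [hi]
  have hPM : P * M = M := by
    have h1 : (1 - P) * (M * Mᴴ) = 0 := by
      rw [Matrix.sub_mul, Matrix.one_mul, hM, hP, hconj, sub_eq_zero]
      congr 3
      funext i
      by_cases hi : μ i = 0 <;> simp [hi]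
    have h2 : (1 - P) * M = 0 := by
      rw [← self_mul_conjTranspose_eq_zero, conjTranspose_mul, ← Matrix.mul_assoc,
        Matrix.mul_assoc _ M, h1, Matrix.zero_mul]
    rw [Matrix.sub_mul, Matrix.one_mul, sub_eq_zero] at h2
    exact h2.symm
  refine ⟨((s⁻¹ : ℝ) : ℂ) • (K * P), ?_, ?_⟩
  · have h3 : (((s⁻¹ : ℝ) : ℂ) • (K * P))ᴴ * (((s⁻¹ : ℝ) : ℂ) • (K * P)) = P := by
      rw [← hPX, ← Matrix.mul_assoc, conjTranspose_smul, conjTranspose_mul, Matrix.smul_mul,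
        Matrix.mul_smul, Matrix.mul_assoc, ← Matrix.mul_assoc _ (K * M), h, Matrix.smul_mul,
        Matrix.mul_smul, smul_smul, smul_smul]
      have h4 : star ((s⁻¹ : ℝ) : ℂ) * ((s⁻¹ : ℝ) : ℂ) * ((s ^ 2 : ℝ) : ℂ) = 1 := by
        rw [Complex.star_def, Complex.conj_ofReal]
        norm_cast
        field_simp
      rw [h4, one_smul]
      calc Xᴴ * (Mᴴ * M * X) = (M * X)ᴴ * (M * X) := by
            rw [conjTranspose_mul M X]; simp only [Matrix.mul_assoc]
        _ = M * X := by rw [hPX, hPh, hPP]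
    rw [IsContraction, h3]
    have h5 : 1 - P = (1 - P)ᴴ * (1 - P) := by
      rw [conjTranspose_sub, conjTranspose_one, hPh, Matrix.mul_sub, Matrix.mul_one, Matrix.sub_mul,
        Matrix.one_mul, hPP, sub_self, sub_zero]
    rw [h5]
    exact posSemidef_conjTranspose_mul_self _
  · rw [Matrix.smul_mul, Matrix.mul_assoc, hPM]

end Operators

/-! ### One measurement step -/

section Measurement

open Matrix
open scoped ComplexOrder

variable {ι : Type u} [Fintype ι] [DecidableEq ι]

theorem opVec_opVec {d d' e : ι → ℕ} (A : Matrix (Idx e) (Idx d') ℂ)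
    (B : Matrix (Idx d') (Idx d) ℂ) (Ψ : JointSpace d) :
    opVec A (opVec B Ψ) = opVec (A * B) Ψ := by
  simp [opVec, mulVec_mulVec]

theorem sum_localOp_conjTranspose_mul_self {d : ι → ℕ} {i : ι} {X : Type*} [Fintype X]
    {d' : X → ι → ℕ} (hd : ∀ x j, j ≠ i → d' x j = d j)
    {K : ∀ x, Matrix (Fin (d' x i)) (Fin (d i)) ℂ} (hK : ∑ x, (K x)ᴴ * K x = 1) :
    ∑ x, (localOp i (K x) : Matrix (Idx (d' x)) (Idx d) ℂ)ᴴ * localOp i (K x) = 1 := by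
  rw [← localOp_one d i, ← hK, localOp_sum]
  exact Finset.sum_congr rfl fun x _ => localOp_conjTranspose_mul_self i (hd x) (K x)

/-- A complete measurement of party `i` preserves the expectation values of every operator that
the Kraus operators commute with, up to the change of the space. -/
theorem sum_trace_kraus {d : ι → ℕ} {i : ι} {X : Type*} [Fintype X] {d' : X → ι → ℕ}
    (hd : ∀ x j, j ≠ i → d' x j = d j) {K : ∀ x, Matrix (Fin (d' x i)) (Fin (d i)) ℂ}
    (hK : ∑ x, (K x)ᴴ * K x = 1) (ρ T : JointOp d) (T' : ∀ x, JointOp (d' x))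
    (hT : ∀ x, T' x * localOp i (K x) = localOp i (K x) * T) :
    ∑ x, trace (T' x * (localOp i (K x) * ρ * (localOp i (K x))ᴴ)) = trace (T * ρ) := by
  have h : ∀ x, trace (T' x * (localOp i (K x) * ρ * (localOp i (K x))ᴴ)) =
      trace ((localOp i (K x) : Matrix (Idx (d' x)) (Idx d) ℂ)ᴴ * localOp i (K x) * (T * ρ)) := by
    intro x
    rw [← Matrix.mul_assoc, ← Matrix.mul_assoc, hT, Matrix.trace_mul_comm]
    simp only [Matrix.mul_assoc]
  simp only [h]
  rw [← trace_sum, ← Finset.sum_mul, sum_localOp_conjTranspose_mul_self hd hK, Matrix.one_mul]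

/-- The normalized state after the outcome with Kraus operator `K`; it is `0` for an outcome of
probability `0`. -/
def postState {d d' : ι → ℕ} (i : ι) (K : Matrix (Fin (d' i)) (Fin (d i)) ℂ) (Ψ : JointSpace d) :
    JointSpace d' :=
  ((‖(opVec (localOp i K) Ψ : JointSpace d')‖⁻¹ : ℝ) : ℂ) • opVec (localOp i K) Ψ

/-- The probability of the outcome with Kraus operator `K`. -/
def outcomeProb {d d' : ι → ℕ} (i : ι) (K : Matrix (Fin (d' i)) (Fin (d i)) ℂ)
    (Ψ : JointSpace d) : ℝ :=
  ‖(opVec (localOp i K) Ψ : JointSpace d')‖ ^ 2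

section

variable {d d' : ι → ℕ} (i : ι) (K : Matrix (Fin (d' i)) (Fin (d i)) ℂ) (Ψ : JointSpace d)

theorem outcomeProb_nonneg : 0 ≤ outcomeProb i K Ψ := sq_nonneg _

theorem norm_smul_postState :
    ((‖(opVec (localOp i K) Ψ : JointSpace d')‖ : ℝ) : ℂ) • postState i K Ψ =
      opVec (localOp i K) Ψ := by
  by_cases h : (opVec (localOp i K) Ψ : JointSpace d') = 0
  · simp [postState, h]
  · rw [postState, smul_smul, ← Complex.ofReal_mul, mul_inv_cancel₀ (norm_ne_zero_iff.2 h),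
      Complex.ofReal_one, one_smul]

theorem outcomeProb_smul_proj_postState :
    ((outcomeProb i K Ψ : ℝ) : ℂ) • proj (postState i K Ψ) =
      localOp i K * proj Ψ * (localOp i K)ᴴ := by
  rw [← proj_opVec, ← norm_smul_postState, proj_smul, outcomeProb]

theorem norm_postState (h : 0 < outcomeProb i K Ψ) : ‖postState i K Ψ‖ = 1 := by
  have h0 : ‖(opVec (localOp i K) Ψ : JointSpace d')‖ ≠ 0 := fun h0 => by
    simp [outcomeProb, h0] at h
  rw [postState, norm_smul, Complex.norm_real, norm_inv, norm_norm, inv_mul_cancel₀ h0]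

end

theorem sum_outcomeProb {d : ι → ℕ} {i : ι} {X : Type*} [Fintype X] {d' : X → ι → ℕ}
    (hd : ∀ x j, j ≠ i → d' x j = d j) {K : ∀ x, Matrix (Fin (d' x i)) (Fin (d i)) ℂ}
    (hK : ∑ x, (K x)ᴴ * K x = 1) {Ψ : JointSpace d} (hΨ : ‖Ψ‖ = 1) :
    ∑ x, outcomeProb i (K x) Ψ = 1 := by
  have h := sum_trace_kraus hd hK (proj Ψ) 1 (fun x => 1) (by simp)
  simp only [Matrix.one_mul, ← proj_opVec, trace_proj, hΨ] at h
  simp only [outcomeProb]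
  exact_mod_cast h.trans (by norm_num : (((1 ^ 2 : ℝ) : ℂ) = ((1 : ℝ) : ℂ)))

omit [Fintype ι] in
theorem cutMatrix_smul {d : ι → ℕ} (i : ι) (c : ℂ) (Ψ : JointSpace d) :
    cutMatrix i (c • Ψ) = c • cutMatrix i Ψ := rfl

omit [Fintype ι] in
theorem cutMatrix_injective {d : ι → ℕ} (i : ι) :
    Function.Injective (cutMatrix i : JointSpace d → _) := by
  intro Ψ Φ h
  ext x
  have := congrFun (congrFun h ((Equiv.piSplitAt i fun j => Fin (d j)) x).1)
    ((Equiv.piSplitAt i fun j => Fin (d j)) x).2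
  simpa only [cutMatrix, of_apply, Prod.mk.eta, Equiv.symm_apply_apply] using this

theorem vonNeumannEntropy_submatrix_cast {m k : ℕ} (h : m = k) (ρ : Matrix (Fin k) (Fin k) ℂ) :
    vonNeumannEntropy (ρ.submatrix (Fin.cast h) (Fin.cast h)) = vonNeumannEntropy ρ := by
  subst h
  rfl

/-- A measurement of party `i` does not change the average marginal of another party, so by
concavity it does not increase the average marginal entropy of that party. -/
theorem sum_marginalEntropy_le_of_ne {d : ι → ℕ} {i l : ι} (hl : l ≠ i) {X : Type*} [Fintype X]
    {d' : X → ι → ℕ} (hd : ∀ x j, j ≠ i → d' x j = d j)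
    {K : ∀ x, Matrix (Fin (d' x i)) (Fin (d i)) ℂ} (hK : ∑ x, (K x)ᴴ * K x = 1)
    {Ψ : JointSpace d} (hΨ : ‖Ψ‖ = 1) :
    ∑ x, outcomeProb i (K x) Ψ * marginalEntropy l (postState i (K x) Ψ) ≤
      marginalEntropy l Ψ := by
  have h := (matEntropy_concave (fun x => outcomeProb i (K x) Ψ)
    (fun x => outcomeProb_nonneg i (K x) Ψ) (sum_outcomeProb hd hK hΨ)
    (fun x => (marginal l (proj (postState i (K x) Ψ))).submatrix (Fin.cast (hd x l hl).symm)
      (Fin.cast (hd x l hl).symm))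
    (fun x => (marginal_posSemidef l _).submatrix _) (ρ := marginal l (proj Ψ)) ?_).1
  · simpa only [marginalEntropy, ← vonNeumannEntropy_eq_matEntropy,
      vonNeumannEntropy_submatrix_cast] using h
  · ext a b
    rw [marginal_apply_eq_trace, ← sum_trace_kraus hd hK (proj Ψ) _ _
      fun x => localOp_mul_localOp_of_ne hl (hd x) (K x) _, Matrix.sum_apply]
    refine Finset.sum_congr rfl fun x _ => ?_
    rw [← outcomeProb_smul_proj_postState, Matrix.mul_smul, trace_smul, Matrix.smul_apply,
      submatrix_apply, marginal_apply_eq_trace]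
    congr 4
    ext s t
    simp [single_apply, Fin.ext_iff]

/-- The marginal entropy of the measuring party is that of all other parties together, whose
average state does not change. Hence its average does not increase, and if it is kept then no
outcome disturbs the other parties, so that each outcome acts on `Ψ` as a local contraction. -/
theorem sum_marginalEntropy_le_self {d : ι → ℕ} {i : ι} {X : Type*} [Fintype X]
    {d' : X → ι → ℕ} (hd : ∀ x j, j ≠ i → d' x j = d j)
    {K : ∀ x, Matrix (Fin (d' x i)) (Fin (d i)) ℂ} (hK : ∑ x, (K x)ᴴ * K x = 1)
    {Ψ : JointSpace d} (hΨ : ‖Ψ‖ = 1) :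
    ∑ x, outcomeProb i (K x) Ψ * marginalEntropy i (postState i (K x) Ψ) ≤
        marginalEntropy i Ψ ∧
      (∑ x, outcomeProb i (K x) Ψ * marginalEntropy i (postState i (K x) Ψ) =
        marginalEntropy i Ψ → ∀ x, 0 < outcomeProb i (K x) Ψ →
          ∃ A : Matrix (Fin (d' x i)) (Fin (d i)) ℂ, IsContraction A ∧
            opVec (localOp i A) Ψ = postState i (K x) Ψ) := by
  set M := cutMatrix i Ψ with hM
  set E := fun x => Equiv.piCongrRight fun j : {j // j ≠ i} => finCongr (hd x j j.2) with hE
  set N := fun x => (cutMatrix i (postState i (K x) Ψ)).submatrix id (E x).symm with hN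
  have hNcut : ∀ x, (N x).submatrix id (E x) = cutMatrix i (postState i (K x) Ψ) := by
    intro x
    simp [hN]
  have hNM : ∀ x, ((‖(opVec (localOp i (K x)) Ψ : JointSpace (d' x))‖ : ℝ) : ℂ) • N x =
      K x * M := by
    intro x
    have h := cutMatrix_opVec_localOp i (hd x) (K x) Ψ
    rw [← norm_smul_postState, cutMatrix_smul] at h
    have h' := congrArg (fun Y => Y.submatrix id (E x).symm) h
    simpa [hN, hE, submatrix_smul] using h'
  have hent : ∀ x, marginalEntropy i (postState i (K x) Ψ) = matEntropy ((N x)ᴴ * N x) := by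
    intro x
    rw [marginalEntropy, vonNeumannEntropy_eq_matEntropy, marginal_proj, ← hNcut,
      conjTranspose_submatrix, submatrix_mul_equiv, submatrix_id_id, matEntropy_mul_conjTranspose]
  have hent0 : marginalEntropy i Ψ = matEntropy (Mᴴ * M) := by
    rw [marginalEntropy, vonNeumannEntropy_eq_matEntropy, marginal_proj,
      matEntropy_mul_conjTranspose]
  have hgram : ∀ x, ((outcomeProb i (K x) Ψ : ℝ) : ℂ) • ((N x)ᴴ * N x) =
      (K x * M)ᴴ * (K x * M) := by
    intro x
    rw [← hNM, conjTranspose_smul, Matrix.smul_mul, Matrix.mul_smul, smul_smul,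
      Complex.star_def, Complex.conj_ofReal, ← Complex.ofReal_mul, outcomeProb, sq]
  have hsum : ∑ x, ((outcomeProb i (K x) Ψ : ℝ) : ℂ) • ((N x)ᴴ * N x) = Mᴴ * M := by
    have : ∀ x, ((outcomeProb i (K x) Ψ : ℝ) : ℂ) • ((N x)ᴴ * N x) =
        Mᴴ * (((K x)ᴴ * K x) * M) := by
      intro x
      rw [hgram, conjTranspose_mul]
      simp only [Matrix.mul_assoc]
    simp only [this]
    rw [← Matrix.mul_sum, ← Matrix.sum_mul, hK, Matrix.one_mul]
  have hconc := matEntropy_concave (fun x => outcomeProb i (K x) Ψ)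
    (fun x => outcomeProb_nonneg i (K x) Ψ) (sum_outcomeProb hd hK hΨ) _
    (fun x => posSemidef_conjTranspose_mul_self (N x)) hsum
  simp only [hent, hent0]
  refine ⟨hconc.1, fun heq x hx => ?_⟩
  have hs : 0 < ‖(opVec (localOp i (K x)) Ψ : JointSpace (d' x))‖ :=
    (norm_nonneg _).lt_of_ne' fun h0 => by simp [outcomeProb, h0] at hx
  obtain ⟨A, hA, hAM⟩ := exists_isContraction_mul_eq (K x) M hs (by
    rw [← hconc.2 heq x hx, ← hgram, outcomeProb])
  refine ⟨A, hA, cutMatrix_injective i ?_⟩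
  rw [cutMatrix_opVec_localOp i (hd x), ← hM, hAM, ← hNM, smul_smul, ← Complex.ofReal_mul,
    inv_mul_cancel₀ hs.ne', Complex.ofReal_one, one_smul, ← hNcut]

omit [Fintype ι] in
theorem isContraction_localFamily {d d' : ι → ℕ} {i : ι} (hd : ∀ j, j ≠ i → d' j = d j)
    {A : Matrix (Fin (d' i)) (Fin (d i)) ℂ} (hA : IsContraction A) (j : ι) :
    IsContraction (localFamily i A j) := by
  by_cases h : j = i
  · subst h
    rwa [localFamily_self]
  · rw [localFamily_of_ne h]
    exact isContraction_of_conjTranspose_mul_self (relabel_conjTranspose_mul_self (hd j h))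

end Measurement

/-! ### LOCC protocols -/

section Protocol

open Matrix
open scoped ComplexOrder

variable {ι : Type u} [Fintype ι] [DecidableEq ι]

theorem localMap_apply {d d' : ι → ℕ} (i : ι) {r : ℕ}
    (K : Fin r → Matrix (Fin (d' i)) (Fin (d i)) ℂ) (ρ : JointOp d) :
    localMap i K ρ = ∑ l, localOp i (K l) * ρ * (localOp i (K l))ᴴ := rfl

theorem IsLOCC.posSemidef {d e : ι → ℕ} {L : JointOp d →ₗ[ℂ] JointOp e} (hL : IsLOCC L) :
    ∀ {ρ : JointOp d}, ρ.PosSemidef → (L ρ).PosSemidef := by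
  induction hL with
  | halt d => exact fun h => h
  | step i n d' hd' r K hK L hL ih =>
    intro ρ hρ
    rw [LinearMap.sum_apply]
    exact posSemidef_sum _ fun k _ => ih k <| posSemidef_sum _ fun l _ =>
      hρ.mul_mul_conjTranspose_same _

theorem IsLOCC.trace_eq {d e : ι → ℕ} {L : JointOp d →ₗ[ℂ] JointOp e} (hL : IsLOCC L) :
    ∀ ρ : JointOp d, trace (L ρ) = trace ρ := by
  induction hL with
  | halt d => exact fun ρ => rfl
  | step i n d' hd' r K hK L hL ih =>
    intro ρ
    rw [LinearMap.sum_apply, trace_sum]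
    simp only [LinearMap.comp_apply, ih]
    have h := sum_trace_kraus (X := Σ k, Fin (r k)) (d' := fun x => d' x.1)
      (fun x => hd' x.1) (K := fun x => K x.1 x.2) (by rw [Fintype.sum_sigma, hK]) ρ 1
      (fun x => 1) (by simp)
    simp only [Matrix.one_mul, Fintype.sum_sigma] at h
    rw [← h]
    exact Finset.sum_congr rfl fun k _ => by rw [localMap_apply, trace_sum]

/-- An LOCC conversion between pure states does not increase any marginal entropy, and if it keeps
all of them then the final state arises from the initial one by a product of contractions. -/
theorem IsLOCC.marginalEntropy_le {d e : ι → ℕ} {L : JointOp d →ₗ[ℂ] JointOp e} (hL : IsLOCC L) :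
    ∀ {Ψ : JointSpace d} {Φ : JointSpace e}, ‖Ψ‖ = 1 → ‖Φ‖ = 1 → L (proj Ψ) = proj Φ →
      (∀ l, marginalEntropy l Φ ≤ marginalEntropy l Ψ) ∧
      ((∀ l, marginalEntropy l Φ = marginalEntropy l Ψ) →
        ∃ A : ∀ j, Matrix (Fin (e j)) (Fin (d j)) ℂ, (∀ j, IsContraction (A j)) ∧
          proj (opVec (tensorOp A) Ψ) = proj Φ) := by
  induction hL with
  | halt d =>
    intro Ψ Φ _ _ h
    change proj Ψ = proj Φ at h
    refine ⟨fun l => by rw [marginalEntropy, marginalEntropy, h], fun _ => ⟨fun j => 1, fun j =>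
      isContraction_of_conjTranspose_mul_self (by simp), ?_⟩⟩
    rw [tensorOp_one, ← h]
    simp [opVec]
  | @step d e i n d' hd' r K hK L hL ih =>
    intro Ψ Φ hΨ hΦ h
    have hd : ∀ (x : Σ k, Fin (r k)) j, j ≠ i → d' x.1 j = d j := fun x => hd' x.1
    have hK' : ∑ x : Σ k, Fin (r k), (K x.1 x.2)ᴴ * K x.1 x.2 = 1 := by
      rw [Fintype.sum_sigma, hK]
    set p := fun x : Σ k, Fin (r k) => outcomeProb i (K x.1 x.2) Ψ with hp
    set φ := fun x : Σ k, Fin (r k) => postState i (K x.1 x.2) Ψ with hφ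
    have hp0 : ∀ x, 0 ≤ p x := fun x => outcomeProb_nonneg i _ Ψ
    have hp1 : ∑ x, p x = 1 := sum_outcomeProb hd hK' hΨ
    have hsum : ∑ x : Σ k, Fin (r k), L x.1 ((p x : ℂ) • proj (φ x)) = proj Φ := by
      rw [← h, Fintype.sum_sigma, LinearMap.sum_apply]
      refine Finset.sum_congr rfl fun k _ => ?_
      refine (map_sum (L k) _ _).symm.trans (congrArg (L k) ?_)
      exact Finset.sum_congr rfl fun l _ => outcomeProb_smul_proj_postState i _ Ψ
    have hpos : ∀ x : Σ k, Fin (r k), (L x.1 ((p x : ℂ) • proj (φ x))).PosSemidef := fun x =>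
      (hL x.1).posSemidef ((proj_posSemidef _).smul (by exact_mod_cast hp0 x))
    -- the pure state `Φ` is a mixture of the outputs of the branches, so each of them outputs `Φ`
    have hbranch : ∀ x, 0 < p x → ‖φ x‖ = 1 ∧ L x.1 (proj (φ x)) = proj Φ := by
      intro x hx
      have hn : ‖φ x‖ = 1 := norm_postState i _ Ψ hx
      refine ⟨hn, ?_⟩
      have hle : (proj Φ - L x.1 ((p x : ℂ) • proj (φ x))).PosSemidef := by
        rw [← hsum, ← Finset.sum_erase_eq_sub (Finset.mem_univ x)]
        exact posSemidef_sum _ fun y _ => hpos y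
      have := eq_trace_smul_proj hΦ (hpos x) hle
      rw [(hL x.1).trace_eq, trace_smul, trace_proj, hn, map_smul] at this
      have hpx : (p x : ℂ) ≠ 0 := by exact_mod_cast hx.ne'
      refine smul_right_injective _ hpx ?_
      simpa using this
    have hle : ∀ l x, p x * marginalEntropy l Φ ≤ p x * marginalEntropy l (φ x) := by
      intro l x
      rcases (hp0 x).eq_or_lt with h0 | h0
      · simp [← h0]
      · exact mul_le_mul_of_nonneg_left
          ((ih x.1 (hbranch x h0).1 hΦ (hbranch x h0).2).1 l) h0.le
    have havg : ∀ l, ∑ x, p x * marginalEntropy l (φ x) ≤ marginalEntropy l Ψ := by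
      intro l
      by_cases hl : l = i
      · subst hl
        exact (sum_marginalEntropy_le_self hd hK' hΨ).1
      · exact sum_marginalEntropy_le_of_ne hl hd hK' hΨ
    have hconst : ∀ l, ∑ x, p x * marginalEntropy l Φ = marginalEntropy l Φ := fun l => by
      rw [← Finset.sum_mul, hp1, one_mul]
    have hle' : ∀ l, marginalEntropy l Φ ≤ ∑ x, p x * marginalEntropy l (φ x) := fun l => by
      rw [← hconst l]
      exact Finset.sum_le_sum fun x _ => hle l x
    refine ⟨fun l => (hle' l).trans (havg l), fun heq => ?_⟩
    obtain ⟨x, -, hx⟩ : ∃ x ∈ Finset.univ, 0 < p x :=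
      Finset.exists_lt_of_sum_lt (by simp [hp1])
    have heq' : ∀ l, marginalEntropy l Φ = marginalEntropy l (φ x) := by
      intro l
      have h1 : ∑ x, p x * marginalEntropy l Φ = ∑ x, p x * marginalEntropy l (φ x) := by
        rw [hconst]
        exact le_antisymm (hle' l) ((havg l).trans (heq l).ge)
      exact mul_left_cancel₀ hx.ne' ((Finset.sum_eq_sum_iff_of_le fun x _ => hle l x).1 h1 x
        (Finset.mem_univ x))
    -- any branch of positive probability yields the required contractions
    obtain ⟨A, hA, hAφ⟩ := (sum_marginalEntropy_le_self hd hK' hΨ).2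
      (le_antisymm (havg i) ((heq i).ge.trans (hle' i))) x hx
    obtain ⟨B, hB, hBφ⟩ := (ih x.1 (hbranch x hx).1 hΦ (hbranch x hx).2).2 heq'
    refine ⟨fun j => B j * localFamily i A j, fun j =>
      (hB j).mul (isContraction_localFamily (hd x) hA j), ?_⟩
    rw [← tensorOp_mul, ← localOp_eq_tensorOp, ← opVec_opVec, hAφ]
    exact hBφ

end Protocol

/-! ### Dilation of contractions to isometries -/

section Dilation

open Matrix
open scoped ComplexOrder

variable {ι : Type u} [Fintype ι] [DecidableEq ι]

theorem exists_isometry_dilation {m k : ℕ} {A : Matrix (Fin m) (Fin k) ℂ} (hA : IsContraction A) :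
    ∃ (V : Matrix (Fin (m + k)) (Fin k) ℂ) (W : Matrix (Fin (m + k)) (Fin m) ℂ),
      Vᴴ * V = 1 ∧ Wᴴ * W = 1 ∧ Wᴴ * V = A := by
  obtain ⟨B, hB⟩ : ∃ B : Matrix (Fin k) (Fin k) ℂ, 1 - Aᴴ * A = Bᴴ * B := by
    open scoped MatrixOrder in
    obtain ⟨B, hB⟩ := CStarAlgebra.nonneg_iff_eq_star_mul_self.1 (PosSemidef.nonneg hA)
    exact ⟨B, hB⟩
  refine ⟨(fromRows A B).submatrix finSumFinEquiv.symm id,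
    (fromRows 1 0).submatrix finSumFinEquiv.symm id, ?_, ?_, ?_⟩
  all_goals
    rw [conjTranspose_submatrix, submatrix_mul_equiv, submatrix_id_id,
      conjTranspose_fromRows_eq_fromCols_conjTranspose, fromCols_mul_fromRows]
  · rw [← hB, add_sub_cancel]
  · simp
  · simp

theorem star_dotProduct_self_of_norm_eq_one {d : ι → ℕ} {Ψ : JointSpace d} (hΨ : ‖Ψ‖ = 1) :
    star Ψ.ofLp ⬝ᵥ Ψ.ofLp = 1 := by
  have h := trace_proj Ψ
  rw [proj_eq_vecMulVec, trace_vecMulVec, dotProduct_comm, hΨ] at h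
  simpa using h

theorem norm_eq_one_of_proj_eq {d : ι → ℕ} {Ψ Φ : JointSpace d} (hΨ : ‖Ψ‖ = 1)
    (h : proj Ψ = proj Φ) : ‖Φ‖ = 1 := by
  have ht := trace_proj Φ
  rw [← h, trace_proj, hΨ] at ht
  have h2 : (1 : ℝ) ^ 2 = ‖Φ‖ ^ 2 := by exact_mod_cast ht
  exact ((sq_eq_sq₀ zero_le_one (norm_nonneg _)).1 h2).symm

/-- Unit vectors with the same projector differ by a phase. -/
theorem exists_phase_of_proj_eq {d : ι → ℕ} {Ψ Φ : JointSpace d} (hΨ : ‖Ψ‖ = 1)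
    (h : proj Ψ = proj Φ) : ∃ c : ℂ, star c * c = 1 ∧ Ψ = c • Φ := by
  have hself := star_dotProduct_self_of_norm_eq_one hΨ
  have hv : Ψ.ofLp = (star Φ.ofLp ⬝ᵥ Ψ.ofLp) • Φ.ofLp := by
    calc Ψ.ofLp = proj Ψ *ᵥ Ψ.ofLp := by
          rw [proj_eq_vecMulVec, vecMulVec_mulVec, hself]
          simp
      _ = _ := by
          rw [h, proj_eq_vecMulVec, vecMulVec_mulVec]
          simp
  refine ⟨star Φ.ofLp ⬝ᵥ Ψ.ofLp, ?_, ?_⟩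
  · generalize star Φ.ofLp ⬝ᵥ Ψ.ofLp = c at hv
    rwa [hv, star_smul, smul_dotProduct, dotProduct_smul,
      star_dotProduct_self_of_norm_eq_one (norm_eq_one_of_proj_eq hΨ h), smul_smul, smul_eq_mul,
      mul_one] at hself
  · ext x
    simpa using congrFun hv x

theorem tensorOp_update_smul {d e : ι → ℕ} (W : ∀ j, Matrix (Fin (e j)) (Fin (d j)) ℂ) (i : ι)
    (c : ℂ) : tensorOp (Function.update W i (c • W i)) = c • tensorOp W := by
  ext x y
  simp only [tensorOp, of_apply, Matrix.smul_apply, smul_eq_mul]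
  rw [← Finset.mul_prod_erase _ _ (Finset.mem_univ i),
    ← Finset.mul_prod_erase _ (fun j => W j (x j) (y j)) (Finset.mem_univ i), Function.update_self,
    Matrix.smul_apply, smul_eq_mul, mul_assoc]
  congr 2
  exact Finset.prod_congr rfl fun j hj => by rw [Function.update_of_ne (Finset.ne_of_mem_erase hj)]

/-- A product of contractions that keeps the norm of `Ψ` acts on it like a product of isometries:
the components of the dilation outside the original spaces vanish. -/
theorem luEquivalent_of_isContraction [Nonempty ι] {d e : ι → ℕ} {Ψ : JointSpace d}
    {Φ : JointSpace e} (hΨ : ‖Ψ‖ = 1) (hΦ : ‖Φ‖ = 1)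
    {A : ∀ j, Matrix (Fin (e j)) (Fin (d j)) ℂ} (hA : ∀ j, IsContraction (A j))
    (h : proj (opVec (tensorOp A) Ψ) = proj Φ) : LUEquivalent Ψ Φ := by
  choose V W hV hW hWV using fun j => exists_isometry_dilation (hA j)
  set Θ : JointSpace e := opVec (tensorOp A) Ψ with hΘ
  have hΘn : ‖Θ‖ = 1 := norm_eq_one_of_proj_eq hΦ h.symm
  obtain ⟨c, hc, hcΘ⟩ := exists_phase_of_proj_eq hΘn h
  have key : tensorOp V *ᵥ Ψ.ofLp = tensorOp W *ᵥ Θ.ofLp := by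
    have dot : ∀ {f g : ι → ℕ} (S : ∀ j, Matrix (Fin (e j + d j)) (Fin (f j)) ℂ)
        (T : ∀ j, Matrix (Fin (e j + d j)) (Fin (g j)) ℂ) (v : Idx f → ℂ) (w : Idx g → ℂ),
        star (tensorOp S *ᵥ v) ⬝ᵥ (tensorOp T *ᵥ w) =
          star v ⬝ᵥ (tensorOp (fun j => (S j)ᴴ * T j) *ᵥ w) := by
      intro f g S T v w
      rw [star_mulVec, ← dotProduct_mulVec, mulVec_mulVec, tensorOp_conjTranspose, tensorOp_mul]
    have h1 : star (tensorOp V *ᵥ Ψ.ofLp) ⬝ᵥ (tensorOp V *ᵥ Ψ.ofLp) = 1 := by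
      simp only [dot, hV, tensorOp_one, one_mulVec, star_dotProduct_self_of_norm_eq_one hΨ]
    have h2 : star (tensorOp W *ᵥ Θ.ofLp) ⬝ᵥ (tensorOp W *ᵥ Θ.ofLp) = 1 := by
      simp only [dot, hW, tensorOp_one, one_mulVec, star_dotProduct_self_of_norm_eq_one hΘn]
    have h3 : star (tensorOp W *ᵥ Θ.ofLp) ⬝ᵥ (tensorOp V *ᵥ Ψ.ofLp) = 1 := by
      simp only [dot, hWV]
      exact star_dotProduct_self_of_norm_eq_one hΘn
    have h4 : star (tensorOp V *ᵥ Ψ.ofLp) ⬝ᵥ (tensorOp W *ᵥ Θ.ofLp) = 1 := by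
      rw [← star_one ℂ, ← h3, star_dotProduct]
    rw [← sub_eq_zero, ← dotProduct_star_self_eq_zero, star_sub, sub_dotProduct,
      dotProduct_sub, dotProduct_sub, h1, h2, h3, h4]
    simp
  -- the phase `c` is absorbed into the isometry of one party; this needs a party to exist
  let i : ι := Classical.arbitrary ι
  refine ⟨fun j => e j + d j, V, Function.update W i (c • W i), hV, fun j => ?_, ?_⟩
  · by_cases hj : j = i
    · subst hj
      rw [Function.update_self, conjTranspose_smul, Matrix.smul_mul, Matrix.mul_smul, smul_smul, hc,
        hW, one_smul]
    · rw [Function.update_of_ne hj, hW]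
  · rw [tensorOp_update_smul, key, hcΘ, smul_mulVec, WithLp.ofLp_smul, mulVec_smul]

theorem LUEquivalent.symm {d e : ι → ℕ} {Ψ : JointSpace d} {Φ : JointSpace e}
    (h : LUEquivalent Ψ Φ) : LUEquivalent Φ Ψ := by
  obtain ⟨f, V, W, hV, hW, h⟩ := h
  exact ⟨f, W, V, hW, hV, h.symm⟩

theorem luEquivalent_of_exactlyReducible [Nonempty ι] {d e : ι → ℕ} {Ψ : JointSpace d}
    {Φ : JointSpace e} (hΨ : ‖Ψ‖ = 1) (hΦ : ‖Φ‖ = 1) (h : MarginallyIsentropic Ψ Φ)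
    (hr : ExactlyReducible Φ Ψ) : LUEquivalent Ψ Φ := by
  obtain ⟨L, hL, hLΨ⟩ := hr
  obtain ⟨A, hA, hAΨ⟩ := (hL.marginalEntropy_le hΨ hΦ hLΨ.symm).2 fun l => (h l).symm
  exact luEquivalent_of_isContraction hΨ hΦ hA hAΨ

end Dilation
end MultiLOCC
end

theorem theorem1 {ι : Type*} [Fintype ι] [DecidableEq ι] [Nonempty ι] (d e : ι → ℕ)
    (Ψ : MultiLOCC.JointSpace d) (Φ : MultiLOCC.JointSpace e) (hΨ : ‖Ψ‖ = 1) (hΦ : ‖Φ‖ = 1)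
    (h : MultiLOCC.MarginallyIsentropic Ψ Φ) :
    MultiLOCC.LUEquivalent Ψ Φ ∨ MultiLOCC.LOCCIncomparable Ψ Φ := by
  by_cases h1 : MultiLOCC.ExactlyReducible Φ Ψ
  · exact Or.inl (MultiLOCC.luEquivalent_of_exactlyReducible hΨ hΦ h h1)
  by_cases h2 : MultiLOCC.ExactlyReducible Ψ Φ
  · exact Or.inl (MultiLOCC.luEquivalent_of_exactlyReducible hΦ hΨ (fun l => (h l).symm) h2).symm
  exact Or.inr ⟨h1, h2⟩
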